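/- **Setting.** Let $d\ge 1$. A generalized linear model with covariates in $\mathbb R^d$ is given by a $\sigma$-finite measure $\nu$ on $\mathbb R$, a dispersion value $c(\sigma)>0$, a measurable $h(\cdot,\sigma)\ge 0$, a twice continuously differentiable $\psi:\mathbb R\to\mathbb R$ such that for every $u\in\mathbb R$ the function $y\mapsto h(y,\sigma)\exp\{(yu-\psi(u))/c(\sigma)\}$ is a probability density with respect to $\nu$, and a probability law $f_{\boldsymbol x}$ on $\mathbb R^d$. For $\beta\in\mathbb R^d$, an observation $(y,\boldsymbol x)$ consists of $\boldsymbol x\sim f_{\boldsymbol x}$ and, given $\boldsymbol x$, a response $y$ with $\nu$-density $$f_\beta(y\mid \boldsymbol x)=h(y,\sigma)\exp\Big(\frac{y\,\boldsymbol x^\top\beta-\psi(\boldsymbol x^\top\beta)}{c(\sigma)}\Big).$$ All components except $\beta$ are known. A randomized algorithm $M$ on data sets of $n$ records is $(\varepsilon,\delta)$-differentially private if $\mathbb P(M(\boldsymbol Z)\in S)\le e^{\varepsilon}\,\mathbb P(M(\boldsymbol Z')\in S)+\delta$ for all data sets $\boldsymbol Z,\boldsymbol Z'$ differing in one record and all measurable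 $S$; $\mathcal M_{\varepsilon,\delta}$ is the set of such algorithms mapping $(\mathbb R\times\mathbb R^d)^n$ to $\mathbb R^d$. $\|\beta\|_0$ is the number of nonzero coordinates of $\beta$. **Theorem 5.1.** Let $\gamma_1,\gamma_2,\kappa,K_1,K_2,C,c_1,c_2>0$. There is a constant $c_0>0$ depending only on these numbers such that the following holds for all integers $n\ge 1$ and $1\le s^*\le d$, all real $\varepsilon,\delta$ and every generalized linear model as above. Suppose that - $s^*\le \kappa\, d^{1-\gamma_1}$ (in particular this covers $s^*=o(d^{1-\gamma_1})$); - $\mathbb E(\boldsymbol x\boldsymbol x^\top)$ is diagonal with $\lambda_{\max}(\mathbb E(\boldsymbol x\boldsymbol x^\top))<C$, $\|\boldsymbol x\|_\infty<c_1$ almost surely, and $|\psi''|\le c_2$ on $\mathbb R$; - $0<\varepsilon<1$, $\delta\ge 0$, $s^*\log(d/s^*)\le K_1 n\varepsilon$ and $\delta\le K_2 n^{-(1+\gamma_2)}$. Then, for $n$ i.i.d. observations $(\boldsymbol y,\boldsymbol X)=\{(y_i,\boldsymbol x_i)\}_{i=1}^n$ from the model, $$\inf_{M\in\mathcal M_{\varepsilon,\delta}}\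 \sup_{\beta\in\mathbb R^d,\ \|\beta\|_0\le s^*}\mathbb E\|M(\boldsymbol y,\boldsymbol X)-\beta\|_2^2\ \ge\ c_0\,c(\sigma)\left(\frac{s^*\log(d/s^*)}{n}+\frac{(s^*\log(d/s^*))^2}{n^2\varepsilon^2}\right),$$ where the expectation is over the sample and the randomness of $M$ and may be $+\infty$. -/

import Mathlib

open MeasureTheory ProbabilityTheory
open scoped ENNReal

noncomputable section

/-- A generalized linear model with covariates in `ℝ^d`.  Given the covariate vector `x`, the
response `y ∈ ℝ` has density `h(y, σ) exp ((y u - ψ u) / c(σ))`, `u = xᵀβ`, with respect to the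
fixed dominating measure `base` (Lebesgue measure for continuous responses, a counting measure for
discrete ones), and `x` has the law `design`.  Everything here is known; only `β` is unknown. -/
structure GLM (d : ℕ) where
  /-- dominating measure for the responses -/
  base : Measure ℝ
  base_sigmaFinite : SigmaFinite base
  /-- dispersion parameter -/
  σ : ℝ
  /-- dispersion function -/
  c : ℝ → ℝ
  /-- normalizing factor `h(y, σ)` -/
  h : ℝ → ℝ → ℝ
  /-- partition function -/
  ψ : ℝ → ℝ
  /-- law of the covariate vector -/
  design : Measure (EuclideanSpace ℝ (Fin d))
  design_isProbabilityMeasure : IsProbabilityMeasure design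
  c_pos : 0 < c σ
  h_nonneg : ∀ y, 0 ≤ h y σ
  h_measurable : Measurable fun y => h y σ
  ψ_contDiff : ContDiff ℝ 2 ψ
  /-- each `h(y, σ) exp ((y u - ψ u) / c(σ))` is a probability density in `y` -/
  normalized : ∀ u : ℝ,
    ∫⁻ y, ENNReal.ofReal (h y σ * Real.exp ((y * u - ψ u) / c σ)) ∂base = 1

namespace GLM

variable {d : ℕ}

/-- The conditional density `f_β(y | x)`. -/
def condDensity (G : GLM d) (β : EuclideanSpace ℝ (Fin d)) (y : ℝ)
    (x : EuclideanSpace ℝ (Fin d)) : ℝ :=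
  G.h y G.σ * Real.exp ((y * (∑ j, x j * β j) - G.ψ (∑ j, x j * β j)) / G.c G.σ)

/-- The law of one observation `(y, x)` under the parameter `β`. -/
def law (G : GLM d) (β : EuclideanSpace ℝ (Fin d)) :
    Measure (ℝ × EuclideanSpace ℝ (Fin d)) :=
  (G.base.prod G.design).withDensity fun z => ENNReal.ofReal (G.condDensity β z.1 z.2)

/-- The law of an i.i.d. sample `(y_1, x_1), …, (y_n, x_n)` under the parameter `β`. -/
def sampleLaw (G : GLM d) (n : ℕ) (β : EuclideanSpace ℝ (Fin d)) :
    Measure (Fin n → ℝ × EuclideanSpace ℝ (Fin d)) :=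
  Measure.pi fun _ => G.law β

/-- The second moment matrix `E (x xᵀ)` of the covariates. -/
def secondMoment (G : GLM d) : Matrix (Fin d) (Fin d) ℝ :=
  Matrix.of fun i j => ∫ x, x i * x j ∂G.design

end GLM

/-- `(ε, δ)`-differential privacy of a randomized algorithm `M` on data sets of `n` records: the
output laws on two data sets that differ in a single record satisfy
`P (M X ∈ S) ≤ e^ε P (M X' ∈ S) + δ` for all measurable `S`. -/
def IsDifferentiallyPrivate {n : ℕ} {𝓩 𝓡 : Type*} [MeasurableSpace 𝓩] [MeasurableSpace 𝓡]
    (M : Kernel (Fin n → 𝓩) 𝓡) (ε δ : ℝ) : Prop :=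
  ∀ X X' : Fin n → 𝓩, (∃ i, ∀ j, j ≠ i → X j = X' j) →
    ∀ S : Set 𝓡, MeasurableSet S →
      M X S ≤ ENNReal.ofReal (Real.exp ε) * M X' S + ENNReal.ofReal δ

namespace GLM

variable {d : ℕ}

/-- The mean squared error `E ‖M(y, X) - β‖₂²` of the randomized estimator `M` under `β`, the
expectation being over the sample and the randomness of `M` (possibly `∞`). -/
def risk (G : GLM d) {n : ℕ}
    (M : Kernel (Fin n → ℝ × EuclideanSpace ℝ (Fin d)) (EuclideanSpace ℝ (Fin d)))
    (β : EuclideanSpace ℝ (Fin d)) : ℝ≥0∞ :=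
  ∫⁻ X, ∫⁻ b, ENNReal.ofReal (‖b - β‖ ^ 2) ∂(M X) ∂(G.sampleLaw n β)

/-- The `(ε, δ)`-private minimax risk over all `β ∈ ℝ^d` with `‖β‖₀ ≤ s`: the infimum over the
`(ε, δ)`-differentially private randomized estimators of the worst mean squared error. -/
def privateMinimaxRisk (G : GLM d) (n s : ℕ) (ε δ : ℝ) : ℝ≥0∞ :=
  ⨅ (M : Kernel (Fin n → ℝ × EuclideanSpace ℝ (Fin d)) (EuclideanSpace ℝ (Fin d)))
    (_ : IsMarkovKernel M) (_ : IsDifferentiallyPrivate M ε δ),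
    ⨆ (β : EuclideanSpace ℝ (Fin d)) (_ : hammingNorm (fun j => β j) ≤ s), G.risk M β

end GLM

end

/-! Since `β` ranges over an unbounded set, a private estimator with `n * δ ≤ 1 / 16` has infinite
worst-case risk already on one coordinate axis (`GLM.iSup_risk_single_eq_top`). The bound `δ ≤ K₂
n^(-(1+γ₂))` leaves only boundedly many other `n`. For these the claimed rate is at most a constant
times `c(σ)`, and the two-point bound `GLM.exists_le_risk_single` is enough.

For the infinite risk, let record `i` have its own parameter `t i` on the axis, and let `Q t` be the
law of that coordinate of the output. Privacy passes to `Q` as a function of `t`. If the risk were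
bounded, a second-moment change of measure would make `Q t` accurate, to a precision depending only
on `D`, whenever all `t i` lie within `D` of a common point. `not_private_of_accurate` refutes this.

That refutation is of Ramsey type. A location is a sum of digits with very rapidly growing place
values, and record `i` carries only the digits above place `l i`, where `l 0 < l 1 < ...`. The balls
`F a k` around the truncations of the location increase with `k`. The output lies in the ball at `l
n` by accuracy, but on average over the digits lies in the ball at `l 0` at most half the time,
since no record carries that digit. Hence some annulus between consecutive `l i`, `l (i + 1)` has
average mass at least `3 / (8n)`. An ultrafilter fixes this `i` for most `l` and gives a long chain
`y 0 < y 1 < ...` whose consecutive pairs can all occupy positions `i`, `i + 1`. The annuli along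
the chain are disjoint, and privacy for two records makes all of them heavy under a single law,
whose total mass is then exceeded. -/

/-! ### Iterated ultrafilter quantifiers over lists. -/

/-- `EventuallyList U m P`: the property `P` holds for `U`-most `k₁`, `U`-most `k₂`, …, `U`-most
`k_m`, of the list `[k₁, …, k_m]`. -/
def EventuallyList {α : Type*} (U : Ultrafilter α) : ℕ → (List α → Prop) → Prop
  | 0, P => P []
  | m + 1, P => ∀ᶠ k in (U : Filter α), EventuallyList U m fun l => P (k :: l)

namespace EventuallyList

variable {α : Type*} {U : Ultrafilter α}

theorem mono {m : ℕ} {P Q : List α → Prop} (hP : EventuallyList U m P) (h : ∀ l, P l → Q l) :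
    EventuallyList U m Q := by
  induction m generalizing P Q with
  | zero => exact h _ hP
  | succ m ih => exact Filter.Eventually.mono hP fun k hk => ih hk fun l => h _

theorem and {m : ℕ} {P Q : List α → Prop} (hP : EventuallyList U m P)
    (hQ : EventuallyList U m Q) : EventuallyList U m fun l => P l ∧ Q l := by
  induction m generalizing P Q with
  | zero => exact ⟨hP, hQ⟩
  | succ m ih =>
    exact (Filter.Eventually.and hP hQ).mono fun k hk => ih hk.1 hk.2

theorem forall_fin {m N : ℕ} {P : Fin N → List α → Prop} (h : ∀ j, EventuallyList U m (P j)) :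
    EventuallyList U m fun l => ∀ j, P j l := by
  induction m generalizing P with
  | zero => exact h
  | succ m ih =>
    exact (Filter.eventually_all.2 h).mono fun k hk => ih hk

/-- This is the pigeonhole step and the reason for an ultrafilter: a finite disjunction that holds
for most elements has a disjunct that does, at each level of the iteration. -/
theorem exists_fin {m N : ℕ} {P : Fin N → List α → Prop}
    (h : EventuallyList U m fun l => ∃ j, P j l) : ∃ j, EventuallyList U m (P j) := by
  induction m generalizing P with
  | zero => exact h
  | succ m ih =>
    exact Ultrafilter.eventually_exists_iff.1 (Filter.Eventually.mono h fun k hk => ih hk)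

theorem exists_list {m : ℕ} {P : List α → Prop} (h : EventuallyList U m P) :
    ∃ l, l.length = m ∧ P l := by
  induction m generalizing P with
  | zero => exact ⟨[], rfl, h⟩
  | succ m ih =>
    obtain ⟨k, hk⟩ := Filter.Eventually.exists h
    obtain ⟨l, hl, hP⟩ := ih hk
    exact ⟨k :: l, by simp [hl], hP⟩

theorem length_eq (m : ℕ) : EventuallyList U m fun l => l.length = m := by
  induction m with
  | zero => rfl
  | succ m ih => exact Filter.Eventually.of_forall fun k => ih.mono fun l hl => by simp [hl]

theorem append {a b : ℕ} {P : List α → Prop} (h : EventuallyList U (a + b) P) :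
    EventuallyList U a fun l₁ => EventuallyList U b fun l₂ => P (l₁ ++ l₂) := by
  induction a generalizing P with
  | zero => simpa [EventuallyList] using h
  | succ a ih =>
    rw [Nat.succ_add] at h
    exact Filter.Eventually.mono h fun k hk => ih hk

theorem forall_mem {m : ℕ} {p : α → Prop} (h : ∀ᶠ k in (U : Filter α), p k) :
    EventuallyList U m fun l => ∀ x ∈ l, p x := by
  induction m with
  | zero => simp [EventuallyList]
  | succ m ih =>
    exact h.mono fun k hk => ih.mono fun l hl => by simpa [hk] using hl

theorem pairwise {m : ℕ} {r : α → α → Prop} (h : ∀ k, ∀ᶠ x in (U : Filter α), r k x) :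
    EventuallyList U m fun l => l.Pairwise r := by
  induction m with
  | zero => simp [EventuallyList]
  | succ m ih =>
    refine Filter.Eventually.of_forall fun k => ((forall_mem (h k)).and ih).mono fun l hl => ?_
    simpa using hl

/-- If `P` holds for most lists of length `a + (b + 2)`, then there is a sequence `y` such that
for each `N` a common initial segment and a common final segment complete all the pairs of
consecutive terms `y j`, `y (j + 1)` with `j < N` to lists satisfying `P`. -/
theorem exists_consecutive {a b : ℕ} {P : List α → Prop}
    (h : EventuallyList U (a + (b + 2)) P) (N : ℕ) :
    ∃ (l₁ : List α) (y : ℕ → α) (l₂ : List α), l₁.length = a ∧ l₂.length = b ∧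
      ∀ j < N, P (l₁ ++ y j :: y (j + 1) :: l₂) := by
  obtain ⟨l₁, h₁, hl₁⟩ := h.append.exists_list
  set S : α → α → Prop := fun y y' => EventuallyList U b fun l₂ => P (l₁ ++ y :: y' :: l₂)
  set T : α → Prop := fun y => ∀ᶠ y' in (U : Filter α), S y y'
  have hT : ∀ᶠ y in (U : Filter α), T y := hl₁
  -- Keeping `T` true of the new term allows the chain to be continued. The final segment is chosen
  -- only after the whole chain, so that it serves all pairs at once.
  have step : ∀ y : {y // T y}, ∃ y' : {y // T y}, S y y' := fun y => by
    obtain ⟨y', hy', hS⟩ := (hT.and y.2).exists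
    exact ⟨⟨y', hy'⟩, hS⟩
  choose f hf using step
  obtain ⟨y₀, hy₀⟩ := hT.exists
  let y : ℕ → {y // T y} := fun j => f^[j] ⟨y₀, hy₀⟩
  have hS : ∀ j, S (y j) (y (j + 1)) := fun j => by
    have : y (j + 1) = f (y j) := Function.iterate_succ_apply' f j _
    rw [this]
    exact hf _
  obtain ⟨l₂, h₂, hl₂⟩ := (forall_fin (N := N) fun j => hS j).exists_list
  exact ⟨l₁, fun j => y j, l₂, h₁, h₂, fun j hj => hl₂ ⟨j, hj⟩⟩

end EventuallyList

/-! ### Locations written in digits at rapidly growing scales. -/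

/-- Greedy recursion on the pair of the current radius and the sum of the place values so far, with
`w k = 2 * R k + 1`. The conditions say that one digit separates balls of radius `R k`, that
dropping it keeps the balls nested, and that `R k` covers the error caused by all lower digits. -/
theorem exists_scales (r : ℝ → ℝ) :
    ∃ R w : ℕ → ℝ, (∀ k, 0 ≤ w k) ∧ (∀ k, 2 * R k < w k) ∧ (∀ k, R k + w k ≤ R (k + 1)) ∧
      ∀ k, r (∑ j ∈ Finset.range k, w j) ≤ R k := by
  let step : ℝ × ℝ → ℝ × ℝ := fun p =>
    (max (r (p.2 + (2 * p.1 + 1))) (p.1 + (2 * p.1 + 1)), p.2 + (2 * p.1 + 1))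
  let p : ℕ → ℝ × ℝ := fun k => step^[k] (max (r 0) 0, 0)
  have hp : ∀ k, p (k + 1) = step (p k) := fun k => Function.iterate_succ_apply' step k _
  have hR : ∀ k, 0 ≤ (p k).1 := fun k => by
    induction k with
    | zero => exact le_max_right _ _
    | succ k ih =>
      rw [hp]
      exact le_max_of_le_right (by linarith)
  have hD : ∀ k, (p k).2 = ∑ j ∈ Finset.range k, (2 * (p j).1 + 1) := fun k => by
    induction k with
    | zero => rfl
    | succ k ih => rw [hp, Finset.sum_range_succ, ← ih]
  refine ⟨fun k => (p k).1, fun k => 2 * (p k).1 + 1, fun k => by linarith [hR k],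
    fun k => by linarith, fun k => ?_, fun k => ?_⟩
  · change _ ≤ (p (k + 1)).1
    rw [hp]
    exact le_max_right _ _
  · rw [← hD]
    cases k with
    | zero => exact le_max_left _ _
    | succ k =>
      change _ ≤ (p (k + 1)).1
      rw [hp]
      exact le_max_left _ _

/-- The real number with digits `1` at the places in `a` and `0` elsewhere, with place values `w`,
all places below `k` being dropped. -/
noncomputable def digitSum (w : ℕ → ℝ) (a : Finset ℕ) (k : ℕ) : ℝ := ∑ j ∈ a with k ≤ j, w j

section digitSum

variable {w : ℕ → ℝ}

theorem digitSum_insert_of_lt {a : Finset ℕ} {k K : ℕ} (h : K < k) :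
    digitSum w (insert K a) k = digitSum w a k := by
  rw [digitSum, digitSum, Finset.filter_insert, if_neg (by omega)]

theorem digitSum_insert_self {a : Finset ℕ} {K : ℕ} (h : K ∉ a) :
    digitSum w (insert K a) K = w K + digitSum w a K := by
  rw [digitSum, digitSum, Finset.filter_insert, if_pos le_rfl,
    Finset.sum_insert (by simp [h])]

theorem abs_digitSum_sub_le (hw : ∀ k, 0 ≤ w k) (a : Finset ℕ) {k K : ℕ} (h : k ≤ K) :
    |digitSum w a k - digitSum w a K| ≤ ∑ j ∈ Finset.Ico k K, w j := by
  have : digitSum w a k = digitSum w a K + ∑ j ∈ a with k ≤ j ∧ j < K, w j := by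
    rw [digitSum, digitSum, ← Finset.sum_union]
    · congr 1
      ext j
      simp only [Finset.mem_filter, Finset.mem_union]
      constructor
      · rintro ⟨h1, h2⟩
        by_cases h3 : K ≤ j
        · exact Or.inl ⟨h1, h3⟩
        · exact Or.inr ⟨h1, h2, by omega⟩
      · rintro (⟨h1, h2⟩ | ⟨h1, h2, h3⟩)
        · exact ⟨h1, by omega⟩
        · exact ⟨h1, h2⟩
    · refine Finset.disjoint_filter.2 fun j _ h1 h2 => by omega
  rw [this, add_sub_cancel_left, abs_of_nonneg (Finset.sum_nonneg fun j _ => hw j)]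
  refine Finset.sum_le_sum_of_subset_of_nonneg (fun j hj => ?_) fun j _ _ => hw j
  simp only [Finset.mem_filter] at hj
  simpa using hj.2

/-- Passing from `k` to `k + 1` moves the centre by at most `w k`, which the growth of the radius
absorbs. -/
theorem monotone_closedBall_digitSum {R : ℕ → ℝ} (hw : ∀ k, 0 ≤ w k)
    (hR : ∀ k, R k + w k ≤ R (k + 1)) (a : Finset ℕ) :
    Monotone fun k => Metric.closedBall (digitSum w a k) (R k) := by
  refine monotone_nat_of_le_succ fun k => Metric.closedBall_subset_closedBall' ?_
  have := abs_digitSum_sub_le hw a (Nat.le_succ k)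
  rw [Real.dist_eq]
  simp at this
  linarith [hR k]

theorem disjoint_closedBall_digitSum_insert {R : ℕ → ℝ} {a : Finset ℕ} {K : ℕ} (ha : K ∉ a)
    (hR : 2 * R K < w K) :
    Disjoint (Metric.closedBall (digitSum w a K) (R K))
      (Metric.closedBall (digitSum w (insert K a) K) (R K)) := by
  refine Metric.closedBall_disjoint_closedBall ?_
  rw [digitSum_insert_self ha, Real.dist_eq, abs_sub_comm, add_sub_cancel_right]
  linarith [le_abs_self (w K)]

end digitSum

/-- No estimator of a real location from parameters known to a resolution `κ i` recovers, on
average over the digits, the digit at the finest resolution with probability more than `1 / 2`. -/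
theorem sum_measureReal_closedBall_le_half {n N : ℕ} {w R : ℕ → ℝ} (hR : ∀ k, 2 * R k < w k)
    (Q : (Fin n → ℝ) → Measure ℝ) [∀ t, IsProbabilityMeasure (Q t)] (κ : ℕ → ℕ) {K : ℕ}
    (hK : ∀ i < n, K ≤ κ i) (hN : K < N) :
    ∑ a ∈ (Finset.range N).powerset,
      (Q fun i => digitSum w a (κ i + 1)).real (Metric.closedBall (digitSum w a K) (R K))
      ≤ 2 ^ N / 2 := by
  have hins : Finset.range N = insert K ((Finset.range N).erase K) :=
    (Finset.insert_erase (by simpa using hN)).symm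
  have hnot : K ∉ (Finset.range N).erase K := by simp
  -- Digit sets are paired by toggling `K`. The data are the same for both members of a pair, while
  -- the two target balls are disjoint, so each pair contributes at most `1`.
  rw [hins, Finset.sum_powerset_insert hnot, ← Finset.sum_add_distrib]
  calc _ ≤ ∑ a ∈ ((Finset.range N).erase K).powerset, (1 : ℝ) := by
        refine Finset.sum_le_sum fun a ha => ?_
        have hKa : K ∉ a := fun h => hnot (Finset.mem_powerset.1 ha h)
        have hdat : (fun i : Fin n => digitSum w (insert K a) (κ i + 1)) =
            fun i : Fin n => digitSum w a (κ i + 1) := by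
          funext i
          exact digitSum_insert_of_lt (Nat.lt_succ_of_le (hK i i.2))
        rw [hdat, ← measureReal_union (disjoint_closedBall_digitSum_insert hKa (hR K))
          Metric.isClosed_closedBall.measurableSet]
        exact measureReal_le_one
    _ = 2 ^ N / 2 := by
        obtain ⟨N, rfl⟩ : ∃ M, N = M + 1 := ⟨N - 1, by omega⟩
        rw [Finset.sum_const, Finset.card_powerset, Finset.card_erase_of_mem (by simpa using hN)]
        simp [pow_succ]

/-! ### Impossibility of private location estimation on the line. -/

theorem sum_measureReal_diff_of_monotone {Ω : Type*} [MeasurableSpace Ω] (μ : Measure Ω)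
    [IsFiniteMeasure μ] {F : ℕ → Set Ω} (hF : ∀ k, MeasurableSet (F k)) (κ : ℕ → ℕ) {m : ℕ}
    (hκ : ∀ i < m, F (κ i) ⊆ F (κ (i + 1))) :
    ∑ i ∈ Finset.range m, μ.real (F (κ (i + 1)) \ F (κ i)) = μ.real (F (κ m)) - μ.real (F (κ 0)) := by
  rw [← Finset.sum_range_sub (fun i => μ.real (F (κ i)))]
  exact Finset.sum_congr rfl fun i hi =>
    measureReal_sdiff (hκ i (Finset.mem_range.1 hi)) (hF _)

theorem List.Pairwise.getD_lt {l : List ℕ} (h : l.Pairwise (· < ·)) {i j : ℕ} (hij : i < j)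
    (hj : j < l.length) : l.getD i 0 < l.getD j 0 := by
  rw [List.getD_eq_getElem _ _ hj, List.getD_eq_getElem _ _ (hij.trans hj)]
  exact List.pairwise_iff_getElem.1 h i j _ hj hij

/-- There is no private estimator of a location in `ℝ` which, uniformly over the location, has
error at most `r D` with probability `7 / 8` if the records come from parameters at distance at
most `D` from the location. -/
theorem not_private_of_accurate {n : ℕ} (hn : 1 ≤ n) {e δ : ℝ} (he : 1 ≤ e) (he3 : e ≤ 3)
    (hδ : 0 ≤ δ) (hnδ : n * δ ≤ 1 / 16)
    (Q : (Fin n → ℝ) → Measure ℝ) [∀ t, IsProbabilityMeasure (Q t)]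
    (hDP : ∀ t t' i, (∀ j, j ≠ i → t j = t' j) → ∀ S, MeasurableSet S →
      (Q t).real S ≤ e * (Q t').real S + δ)
    (hacc : ∀ D : ℝ, ∃ r : ℝ, ∀ t b, (∀ i, |t i - b| ≤ D) →
      (Q t).real {x | r < |x - b|} ≤ 1 / 8) : False := by
  choose r hr using hacc
  obtain ⟨R, w, hw, hRw, hR, hrR⟩ := exists_scales r
  let F : Finset ℕ → ℕ → Set ℝ := fun a k => Metric.closedBall (digitSum w a k) (R k)
  have hF : ∀ a k, MeasurableSet (F a k) := fun a k => Metric.isClosed_closedBall.measurableSet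
  have hFm : ∀ a, Monotone (F a) := fun a => monotone_closedBall_digitSum hw hR a
  let dat : Finset ℕ → List ℕ → Fin n → ℝ := fun a l i => digitSum w a (l.getD i 0 + 1)
  have hn0 : (0 : ℝ) < n := by exact_mod_cast hn
  let U : Ultrafilter ℕ := Filter.hyperfilter ℕ
  -- Entries `0, ..., n - 1` are the resolutions of the records, entry `n` is the scale of the
  -- accuracy ball, and entry `n + 1` bounds the digits averaged over.
  have key : EventuallyList U (n + 2) fun l => ∃ i : Fin n,
      l.Pairwise (· < ·) ∧ 3 / (8 * n) * 2 ^ (l.getD (n + 1) 0) ≤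
        ∑ a ∈ (Finset.range (l.getD (n + 1) 0)).powerset,
          (Q (dat a l)).real (F a (l.getD (i + 1) 0) \ F a (l.getD i 0)) := by
    have hpw : EventuallyList U (n + 2) fun l => l.Pairwise (· < ·) :=
      EventuallyList.pairwise fun k =>
        (Filter.eventually_gt_atTop k).filter_mono Nat.hyperfilter_le_atTop
    refine (hpw.and (EventuallyList.length_eq _)).mono fun l hl => ?_
    obtain ⟨hl, hlen⟩ := hl
    by_contra! hcon
    set N := l.getD (n + 1) 0
    have hlow := sum_measureReal_closedBall_le_half (N := N) hRw Q (fun i => l.getD i 0)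
      (K := l.getD 0 0) (fun i hi => by
        rcases Nat.eq_zero_or_pos i with rfl | h0
        · exact le_rfl
        · exact (hl.getD_lt h0 (by omega)).le) (hl.getD_lt (by omega) (by omega))
    -- All records carry the digits from place `l n` upwards, so they differ from that truncation by
    -- at most the sum of the lower place values.
    have hhigh : ∀ a, 7 / 8 ≤ (Q (dat a l)).real (F a (l.getD n 0)) := fun a => by
      have h := hr (∑ j ∈ Finset.range (l.getD n 0), w j) (dat a l) (digitSum w a (l.getD n 0))
        fun i => (abs_digitSum_sub_le hw a (hl.getD_lt i.2 (by omega))).trans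
          (Finset.sum_le_sum_of_subset_of_nonneg (fun j hj => by simp at hj ⊢; omega)
            fun j _ _ => hw j)
      have hsub : (F a (l.getD n 0))ᶜ ⊆
          {x | r (∑ j ∈ Finset.range (l.getD n 0), w j) < |x - digitSum w a (l.getD n 0)|} := by
        intro x hx
        simp only [F, Set.mem_compl_iff, Metric.mem_closedBall, Real.dist_eq, not_le] at hx
        exact (hrR _).trans_lt hx
      have h2 := (measureReal_mono hsub (measure_ne_top (Q (dat a l)) _)).trans h
      rw [probReal_compl_eq_one_sub (hF _ _)] at h2
      linarith
    have htel : ∀ a, ∑ i ∈ Finset.range n,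
        (Q (dat a l)).real (F a (l.getD (i + 1) 0) \ F a (l.getD i 0)) =
        (Q (dat a l)).real (F a (l.getD n 0)) - (Q (dat a l)).real (F a (l.getD 0 0)) := fun a =>
      sum_measureReal_diff_of_monotone _ (hF a) (fun i => l.getD i 0) fun i hi =>
        hFm a (hl.getD_lt (Nat.lt_succ_self i) (by omega)).le
    have hsum : ∑ i : Fin n, ∑ a ∈ (Finset.range N).powerset,
        (Q (dat a l)).real (F a (l.getD (i + 1) 0) \ F a (l.getD i 0)) ≥ 3 / 8 * 2 ^ N := by
      rw [Finset.sum_comm]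
      simp_rw [Finset.sum_range (n := n)] at htel
      simp_rw [htel]
      rw [Finset.sum_sub_distrib]
      have h78 : ∑ a ∈ (Finset.range N).powerset, (7 / 8 : ℝ) ≤
          ∑ a ∈ (Finset.range N).powerset, (Q (dat a l)).real (F a (l.getD n 0)) :=
        Finset.sum_le_sum fun a _ => hhigh a
      rw [Finset.sum_const, Finset.card_powerset, Finset.card_range, nsmul_eq_mul] at h78
      push_cast at h78
      linarith
    have hlt : ∑ i : Fin n, ∑ a ∈ (Finset.range N).powerset,
        (Q (dat a l)).real (F a (l.getD (i + 1) 0) \ F a (l.getD i 0)) <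
        ∑ i : Fin n, 3 / (8 * (n : ℝ)) * 2 ^ N :=
      Finset.sum_lt_sum_of_nonempty ⟨⟨0, hn⟩, Finset.mem_univ _⟩ fun i _ => hcon i hl
    rw [Finset.sum_const, Finset.card_univ, Fintype.card_fin, nsmul_eq_mul] at hlt
    have : (n : ℝ) * (3 / (8 * n) * 2 ^ N) = 3 / 8 * 2 ^ N := by field_simp
    linarith
  obtain ⟨i, hi⟩ := EventuallyList.exists_fin key
  obtain ⟨b, hb⟩ : ∃ b, n = i + (b + 1) := ⟨n - i - 1, by have := i.2; omega⟩
  rw [show n + 2 = i + ((b + 1) + 2) by omega] at hi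
  -- The chain length `72 * n + 1` is the first to violate the bound `M / (8n) ≤ 9` reached at the
  -- end. As `l₂` is nonempty, the last entry `N` is common to all lists.
  obtain ⟨l₁, y, l₂, h₁, h₂, hy⟩ := hi.exists_consecutive (72 * n + 1)
  set M := 72 * n + 1
  let ls : ℕ → ℕ → List ℕ := fun x x' => l₁ ++ x :: x' :: l₂
  have hget : ∀ x x' (p : ℕ), p ≠ i → p ≠ i + 1 → ∀ z z', (ls x x').getD p 0 = (ls z z').getD p 0 := by
    intro x x' p hp hp' z z'
    rcases lt_or_ge p i with h | h
    · simp only [ls]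
      rw [List.getD_append _ _ _ _ (by omega), List.getD_append _ _ _ _ (by omega)]
    · obtain ⟨q, rfl⟩ : ∃ q, p = l₁.length + (q + 2) := ⟨p - i - 2, by omega⟩
      simp only [ls]
      rw [List.getD_append_right _ _ _ _ (by omega), List.getD_append_right _ _ _ _ (by omega)]
      simp
  have hget0 : ∀ x x', (ls x x').getD i 0 = x := fun x x' => by
    simp only [ls]
    rw [List.getD_append_right _ _ _ _ (by omega)]
    simp [h₁]
  have hget1 : ∀ x x', (ls x x').getD (i + 1) 0 = x' := fun x x' => by
    simp only [ls]
    rw [List.getD_append_right _ _ _ _ (by omega)]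
    simp [h₁]
  set N := (ls (y 0) (y 1)).getD (n + 1) 0
  have hN : ∀ x x', (ls x x').getD (n + 1) 0 = N := fun x x' =>
    hget _ _ _ (by omega) (by omega) _ _
  have hDP' : ∀ a l l' (p : ℕ), (∀ j, j ≠ p → l.getD j 0 = l'.getD j 0) → ∀ S, MeasurableSet S →
      (Q (dat a l)).real S ≤ e * (Q (dat a l')).real S + δ := by
    intro a l l' p h S hS
    -- Entry `n` belongs to no record. Changing it leaves the data unchanged, and privacy then
    -- applies trivially at record `0`.
    by_cases hp : p < n
    · refine hDP _ _ ⟨p, hp⟩ (fun j hj => ?_) S hS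
      simp only [dat]
      rw [h j fun hjp => hj (Fin.ext hjp)]
    · refine hDP _ _ ⟨0, hn⟩ (fun j _ => ?_) S hS
      simp only [dat]
      rw [h j (by have := j.2; omega)]
  have hgood : ∀ j < M, y j < y (j + 1) ∧ 3 / (8 * n) * 2 ^ N ≤
      ∑ a ∈ (Finset.range N).powerset,
        (Q (dat a (ls (y j) (y (j + 1))))).real (F a (y (j + 1)) \ F a (y j)) := fun j hj => by
    obtain ⟨h1, h2⟩ := hy j hj
    have h3 := h1.getD_lt (Nat.lt_succ_self i) (by simp [h₁])
    change (ls (y j) (y (j + 1))).getD i 0 < (ls (y j) (y (j + 1))).getD (i + 1) 0 at h3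
    change _ * 2 ^ ((ls (y j) (y (j + 1))).getD (n + 1) 0) ≤
      ∑ a ∈ (Finset.range ((ls (y j) (y (j + 1))).getD (n + 1) 0)).powerset,
        (Q (dat a (ls (y j) (y (j + 1))))).real
          (F a ((ls (y j) (y (j + 1))).getD (i + 1) 0) \ F a ((ls (y j) (y (j + 1))).getD i 0))
      at h2
    rw [hget0, hget1] at h3
    rw [hget0, hget1, hN] at h2
    exact ⟨h3, h2⟩
  -- Entries `i` and `i + 1` are replaced one at a time, giving `e ^ 2 ≤ 9` and `(1 + e) * δ ≤ 4 *
  -- δ`.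
  have htwo : ∀ a j, (Q (dat a (ls (y j) (y (j + 1))))).real (F a (y (j + 1)) \ F a (y j)) ≤
      9 * (Q (dat a (ls (y 0) (y 1)))).real (F a (y (j + 1)) \ F a (y j)) + 4 * δ := fun a j => by
    have hS := (hF a (y (j + 1))).diff (hF a (y j))
    have h1 := hDP' a (ls (y j) (y (j + 1))) (ls (y 0) (y (j + 1))) i (fun p hp => by
      by_cases hp' : p = i + 1
      · rw [hp', hget1, hget1]
      · exact hget _ _ _ hp hp' _ _) _ hS
    have h2 := hDP' a (ls (y 0) (y (j + 1))) (ls (y 0) (y 1)) (i + 1) (fun p hp => by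
      by_cases hp' : p = i
      · rw [hp', hget0, hget0]
      · exact hget _ _ _ hp' hp _ _) _ hS
    set q := (Q (dat a (ls (y 0) (y 1)))).real (F a (y (j + 1)) \ F a (y j))
    set q' := (Q (dat a (ls (y 0) (y (j + 1))))).real (F a (y (j + 1)) \ F a (y j))
    have hq : 0 ≤ q := measureReal_nonneg
    have h3 : e * q' ≤ e * (e * q + δ) := by gcongr
    have h4 : e * e * q ≤ 9 * q := by gcongr; nlinarith
    nlinarith
  -- Under the single reference law the annuli telescope to mass at most `1`.
  have htotal : ∀ a, ∑ j ∈ Finset.range M,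
      (Q (dat a (ls (y j) (y (j + 1))))).real (F a (y (j + 1)) \ F a (y j)) ≤
        9 + M * (4 * δ) := fun a => by
    refine (Finset.sum_le_sum fun j _ => htwo a j).trans ?_
    rw [Finset.sum_add_distrib, ← Finset.mul_sum, sum_measureReal_diff_of_monotone _ (hF a) y
      fun j hj => hFm a (hgood j hj).1.le, Finset.sum_const, Finset.card_range, nsmul_eq_mul]
    have h1 : (Q (dat a (ls (y 0) (y 1)))).real (F a (y M)) ≤ 1 := measureReal_le_one
    have h2 : 0 ≤ (Q (dat a (ls (y 0) (y 1)))).real (F a (y 0)) := measureReal_nonneg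
    linarith
  have hfin : (M : ℝ) * (3 / (8 * n) * 2 ^ N) ≤ 2 ^ N * (9 + M * (4 * δ)) := by
    calc (M : ℝ) * (3 / (8 * n) * 2 ^ N)
        = ∑ j ∈ Finset.range M, 3 / (8 * (n : ℝ)) * 2 ^ N := by
          rw [Finset.sum_const, Finset.card_range, nsmul_eq_mul]
      _ ≤ ∑ j ∈ Finset.range M, ∑ a ∈ (Finset.range N).powerset,
          (Q (dat a (ls (y j) (y (j + 1))))).real (F a (y (j + 1)) \ F a (y j)) :=
          Finset.sum_le_sum fun j hj => (hgood j (Finset.mem_range.1 hj)).2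
      _ ≤ ∑ a ∈ (Finset.range N).powerset, (9 + M * (4 * δ)) := by
          rw [Finset.sum_comm]
          exact Finset.sum_le_sum fun a _ => htotal a
      _ = 2 ^ N * (9 + M * (4 * δ)) := by
          rw [Finset.sum_const, Finset.card_powerset, Finset.card_range, nsmul_eq_mul]
          push_cast
          ring
  have hfin' : (M : ℝ) * (3 / (8 * n)) ≤ 9 + M * (4 * δ) := by
    have : (0 : ℝ) < 2 ^ N := by positivity
    refine le_of_mul_le_mul_left ?_ this
    linarith
  have hδn : δ ≤ 1 / (16 * n) := by
    rw [le_div_iff₀ (by positivity)]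
    linarith
  have hM : (M : ℝ) = 72 * n + 1 := by simp [M]
  have h8 : (M : ℝ) * (1 / (8 * n)) ≤ 9 := by
    have h4 : (M : ℝ) * (4 * δ) ≤ M * (4 * (1 / (16 * n))) := by gcongr
    have : (3 / (8 * n) : ℝ) = 1 / (8 * n) + 4 * (1 / (16 * n)) := by field_simp; norm_num
    rw [this] at hfin'
    linarith
  rw [mul_one_div, div_le_iff₀ (by positivity)] at h8
  linarith

/-! ### Change of measure, product laws and privacy of mixtures. -/

/-- Midpoint convexity of `K / 2 * u ^ 2 - ψ u`, whose second derivative is nonnegative. -/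
theorem add_sub_two_mul_le_of_abs_deriv_deriv_le {ψ : ℝ → ℝ} (hψ : ContDiff ℝ 2 ψ) {K : ℝ}
    (hK : ∀ u, |deriv (deriv ψ) u| ≤ K) (v h : ℝ) :
    ψ (v + h) + ψ (v - h) - 2 * ψ v ≤ K * h ^ 2 := by
  have hd : Differentiable ℝ ψ := hψ.differentiable (by norm_num)
  have hd' : Differentiable ℝ (deriv ψ) :=
    hψ.differentiable_deriv_two
  have h1 : ∀ u, HasDerivAt (fun u => K / 2 * u ^ 2 - ψ u) (K * u - deriv ψ u) u := fun u => by
    have := ((hasDerivAt_pow 2 u).const_mul (K / 2)).sub (hd u).hasDerivAt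
    refine this.congr_deriv ?_
    push_cast
    ring
  have h2 : deriv (fun u => K / 2 * u ^ 2 - ψ u) = fun u => K * u - deriv ψ u :=
    funext fun u => (h1 u).deriv
  have h3 : ∀ u, HasDerivAt (fun u => K * u - deriv ψ u) (K - deriv (deriv ψ) u) u := fun u => by
    have := ((hasDerivAt_id' u).const_mul K).sub (hd' u).hasDerivAt
    rwa [mul_one] at this
  have hconv : ConvexOn ℝ Set.univ fun u => K / 2 * u ^ 2 - ψ u := by
    refine convexOn_univ_of_deriv2_nonneg (fun u => (h1 u).differentiableAt) ?_ fun u => ?_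
    · rw [h2]
      exact fun u => (h3 u).differentiableAt
    · rw [Function.iterate_succ_apply, Function.iterate_one, h2, (h3 u).deriv]
      linarith [le_abs_self (deriv (deriv ψ) u), hK u]
  have := hconv.2 (Set.mem_univ (v + h)) (Set.mem_univ (v - h)) (by norm_num : (0 : ℝ) ≤ 1 / 2)
    (by norm_num : (0 : ℝ) ≤ 1 / 2) (by norm_num)
  simp only [smul_eq_mul] at this
  rw [show 1 / 2 * (v + h) + 1 / 2 * (v - h) = v by ring] at this
  nlinarith

section Measure

variable {Ω : Type*} [MeasurableSpace Ω]

/-- A change of measure bound by the second moment of the density. -/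
theorem lintegral_withDensity_le_of_sq {μ : Measure Ω} {ρ g : Ω → ℝ≥0∞} (hρ : Measurable ρ)
    (hg : Measurable g) (hg1 : ∀ ω, g ω ≤ 1) {K T : ℝ≥0∞} (hK : ∫⁻ ω, ρ ω ^ 2 ∂μ ≤ K)
    (hT : T ≠ 0) (hT' : T ≠ ⊤) :
    ∫⁻ ω, g ω ∂(μ.withDensity ρ) ≤ T * ∫⁻ ω, g ω ∂μ + K / T := by
  rw [lintegral_withDensity_eq_lintegral_mul _ hρ hg]
  calc ∫⁻ ω, (ρ * g) ω ∂μ ≤ ∫⁻ ω, (T * g ω + ρ ω ^ 2 / T) ∂μ := by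
        -- Where `ρ ≤ T` the first term dominates; elsewhere `ρ ≤ ρ ^ 2 / T` and `g ≤ 1`.
        refine lintegral_mono fun ω => ?_
        rw [Pi.mul_apply]
        rcases le_total (ρ ω) T with h | h
        · exact le_add_right (by gcongr)
        · refine le_add_left ?_
          rw [ENNReal.le_div_iff_mul_le (Or.inl hT) (Or.inl hT'), sq]
          calc ρ ω * g ω * T ≤ ρ ω * 1 * ρ ω := by gcongr; exact hg1 ω
            _ = ρ ω * ρ ω := by rw [mul_one]
    _ = T * ∫⁻ ω, g ω ∂μ + (∫⁻ ω, ρ ω ^ 2 ∂μ) / T := by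
        rw [lintegral_add_left (hg.const_mul T), lintegral_const_mul _ hg]
        simp_rw [div_eq_mul_inv]
        rw [lintegral_mul_const _ (hρ.pow_const 2)]
    _ ≤ _ := by gcongr

theorem lintegral_pi_prod {n : ℕ} (μ : Fin n → Measure Ω) [∀ i, IsProbabilityMeasure (μ i)]
    {f : Fin n → Ω → ℝ≥0∞} (hf : ∀ i, Measurable (f i)) :
    ∫⁻ X, ∏ i, f i (X i) ∂(Measure.pi μ) = ∏ i, ∫⁻ x, f i x ∂(μ i) := by
  have := lintegral_prod_eq_prod_lintegral_of_indepFun (μ := Measure.pi μ) Finset.univ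
    (fun i X => f i (X i)) (iIndepFun_pi fun i => (hf i).aemeasurable)
    fun i => (hf i).comp (measurable_pi_apply i)
  rw [this]
  refine Finset.prod_congr rfl fun i _ => ?_
  exact (measurePreserving_eval μ i).lintegral_comp (hf i)

theorem pi_withDensity_prod {n : ℕ} (μ : Fin n → Measure Ω) [∀ i, IsProbabilityMeasure (μ i)]
    {ρ : Fin n → Ω → ℝ≥0∞} (hρ : ∀ i, Measurable (ρ i))
    [∀ i, IsProbabilityMeasure ((μ i).withDensity (ρ i))] :
    Measure.pi (fun i => (μ i).withDensity (ρ i)) =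
      (Measure.pi μ).withDensity fun X => ∏ i, ρ i (X i) := by
  refine Measure.pi_eq fun s hs => ?_
  rw [withDensity_apply _ (MeasurableSet.univ_pi hs),
    ← lintegral_indicator (MeasurableSet.univ_pi hs)]
  calc _ = ∫⁻ X, ∏ i, (s i).indicator (ρ i) (X i) ∂(Measure.pi μ) := by
        refine lintegral_congr fun X => ?_
        by_cases hX : X ∈ Set.univ.pi s
        · rw [Set.indicator_of_mem hX]
          exact Finset.prod_congr rfl fun i _ =>
            (Set.indicator_of_mem (hX i (Set.mem_univ i)) _).symm
        · rw [Set.indicator_of_notMem hX]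
          obtain ⟨i, hi⟩ : ∃ i, X i ∉ s i := by simpa using hX
          exact (Finset.prod_eq_zero (Finset.mem_univ i) (Set.indicator_of_notMem hi _)).symm
    _ = ∏ i, (μ i).withDensity (ρ i) (s i) := by
        rw [lintegral_pi_prod μ fun i => (hρ i).indicator (hs i)]
        exact Finset.prod_congr rfl fun i _ => by
          rw [lintegral_indicator (hs i), withDensity_apply _ (hs i)]

theorem measurable_update_prod {n : ℕ} (i : Fin n) :
    Measurable fun p : (Fin n → Ω) × Ω => Function.update p.1 i p.2 := by
  refine measurable_pi_iff.2 fun j => ?_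
  by_cases hj : j = i
  · subst hj
    simpa using measurable_snd
  · simp only [Function.update_of_ne hj]
    exact (measurable_pi_apply j).comp measurable_fst

/-- Redrawing record `i` from its new law couples the two product laws through samples that differ
only in that record, so that privacy can be applied pointwise. -/
theorem map_update_pi_prod {n : ℕ} (μ μ' : Fin n → Measure Ω) [∀ i, IsProbabilityMeasure (μ i)]
    [∀ i, IsProbabilityMeasure (μ' i)] (i : Fin n) (h : ∀ j, j ≠ i → μ j = μ' j) :
    ((Measure.pi μ).prod (μ' i)).map (fun p => Function.update p.1 i p.2) = Measure.pi μ' := by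
  refine (Measure.pi_eq fun s hs => ?_).symm
  rw [Measure.map_apply (measurable_update_prod i) (MeasurableSet.univ_pi hs)]
  have hpre : (fun p : (Fin n → Ω) × Ω => Function.update p.1 i p.2) ⁻¹' Set.univ.pi s =
      Set.univ.pi (Function.update s i Set.univ) ×ˢ s i := by
    ext p
    simp only [Set.mem_preimage, Set.mem_univ_pi, Set.mem_prod]
    constructor
    · refine fun hp => ⟨fun j => ?_, by simpa using hp i⟩
      by_cases hj : j = i
      · subst hj
        simp
      · simpa [hj] using hp j
    · rintro ⟨h1, h2⟩ j
      by_cases hj : j = i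
      · subst hj
        simpa using h2
      · simpa [hj] using h1 j
  rw [hpre, Measure.prod_prod, Measure.pi_pi, ← Finset.mul_prod_erase _ _ (Finset.mem_univ i),
    ← Finset.mul_prod_erase _ (fun j => μ' j (s j)) (Finset.mem_univ i), mul_comm]
  simp only [Function.update_self, measure_univ, one_mul]
  congr 1
  refine Finset.prod_congr rfl fun j hj => ?_
  have hj' := (Finset.mem_erase.1 hj).1
  rw [Function.update_of_ne hj', h j hj']

/-- The output law of a private algorithm on independent records is private as a function of the
laws of the records. -/
theorem IsDifferentiallyPrivate.bind_pi_le {n : ℕ} {𝓡 : Type*} [MeasurableSpace 𝓡]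
    {M : Kernel (Fin n → Ω) 𝓡} {ε δ : ℝ} (hM : IsDifferentiallyPrivate M ε δ)
    (μ μ' : Fin n → Measure Ω) [∀ i, IsProbabilityMeasure (μ i)]
    [∀ i, IsProbabilityMeasure (μ' i)] (i : Fin n) (h : ∀ j, j ≠ i → μ j = μ' j)
    {S : Set 𝓡} (hS : MeasurableSet S) :
    (Measure.pi μ).bind M S ≤
      ENNReal.ofReal (Real.exp ε) * (Measure.pi μ').bind M S + ENNReal.ofReal δ := by
  rw [Measure.bind_apply hS M.measurable.aemeasurable,
    Measure.bind_apply hS M.measurable.aemeasurable, ← map_update_pi_prod μ μ' i h]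
  have hMS : Measurable fun X => M X S := M.measurable_coe hS
  rw [lintegral_map hMS (measurable_update_prod i)]
  calc ∫⁻ X, M X S ∂(Measure.pi μ) = ∫⁻ p, M p.1 S ∂((Measure.pi μ).prod (μ' i)) := by
        have hM1 : Measurable fun p : (Fin n → Ω) × Ω => M p.1 S := hMS.comp measurable_fst
        rw [lintegral_prod _ hM1.aemeasurable]
        simp
    _ ≤ ∫⁻ p, (ENNReal.ofReal (Real.exp ε) * M (Function.update p.1 i p.2) S +
          ENNReal.ofReal δ) ∂((Measure.pi μ).prod (μ' i)) := by
        refine lintegral_mono fun p => hM _ _ ⟨i, fun j hj => ?_⟩ S hS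
        rw [Function.update_of_ne hj]
    _ = _ := by
        have hM2 : Measurable fun p : (Fin n → Ω) × Ω => M (Function.update p.1 i p.2) S :=
          hMS.comp (measurable_update_prod i)
        rw [lintegral_add_right _ measurable_const, lintegral_const_mul _ hM2]
        simp

end Measure

/-! ### Likelihood ratios and output laws along a coordinate axis. -/

namespace GLM

variable {d : ℕ} (G : GLM d)

theorem condDensity_single (j : Fin d) (b y : ℝ) (x : EuclideanSpace ℝ (Fin d)) :
    G.condDensity (EuclideanSpace.single j b) y x =
      G.h y G.σ * Real.exp ((y * (x j * b) - G.ψ (x j * b)) / G.c G.σ) := by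
  have : ∑ k, x k * (EuclideanSpace.single j b : EuclideanSpace ℝ (Fin d)) k = x j * b := by
    rw [Finset.sum_eq_single j] <;> simp +contextual
  rw [condDensity, this]

theorem measurable_condDensity (β : EuclideanSpace ℝ (Fin d)) :
    Measurable fun z : ℝ × EuclideanSpace ℝ (Fin d) => G.condDensity β z.1 z.2 := by
  have hψ : Measurable G.ψ := G.ψ_contDiff.continuous.measurable
  have hx : Measurable fun z : ℝ × EuclideanSpace ℝ (Fin d) => ∑ j, z.2 j * β j := by
    have : Continuous fun z : ℝ × EuclideanSpace ℝ (Fin d) => ∑ j, z.2 j * β j := by fun_prop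
    exact this.measurable
  exact (G.h_measurable.comp measurable_fst).mul
    (((measurable_fst.mul hx).sub (hψ.comp hx)).div_const _).exp

theorem lintegral_condDensity (β : EuclideanSpace ℝ (Fin d)) :
    ∫⁻ z, ENNReal.ofReal (G.condDensity β z.1 z.2) ∂(G.base.prod G.design) = 1 := by
  have := G.base_sigmaFinite
  have := G.design_isProbabilityMeasure
  rw [lintegral_prod_symm _ (G.measurable_condDensity β).ennreal_ofReal.aemeasurable]
  simp [condDensity, G.normalized]

instance (β : EuclideanSpace ℝ (Fin d)) : IsProbabilityMeasure (G.law β) :=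
  ⟨by rw [law, withDensity_apply _ MeasurableSet.univ, Measure.restrict_univ,
    lintegral_condDensity]⟩

/-- The likelihood ratio of one record between the parameters `b' e_j` and `b e_j`. -/
noncomputable def likelihoodRatio (j : Fin d) (b b' : ℝ) (z : ℝ × EuclideanSpace ℝ (Fin d)) : ℝ :=
  Real.exp ((z.1 * (z.2 j * (b' - b)) - G.ψ (z.2 j * b') + G.ψ (z.2 j * b)) / G.c G.σ)

theorem likelihoodRatio_nonneg (j : Fin d) (b b' : ℝ) (z : ℝ × EuclideanSpace ℝ (Fin d)) :
    0 ≤ G.likelihoodRatio j b b' z :=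
  Real.exp_nonneg _

theorem measurable_likelihoodRatio (j : Fin d) (b b' : ℝ) :
    Measurable (G.likelihoodRatio j b b') := by
  have hψ : Measurable G.ψ := G.ψ_contDiff.continuous.measurable
  have hx : Measurable fun z : ℝ × EuclideanSpace ℝ (Fin d) => z.2 j := by
    have : Continuous fun z : ℝ × EuclideanSpace ℝ (Fin d) => z.2 j := by fun_prop
    exact this.measurable
  exact ((((measurable_fst.mul (hx.mul_const _)).sub (hψ.comp (hx.mul_const _))).add
    (hψ.comp (hx.mul_const _))).div_const _).exp

theorem law_single_eq_withDensity (j : Fin d) (b b' : ℝ) :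
    G.law (EuclideanSpace.single j b') = (G.law (EuclideanSpace.single j b)).withDensity
      fun z => ENNReal.ofReal (G.likelihoodRatio j b b' z) := by
  rw [law, law, ← withDensity_mul _ (G.measurable_condDensity _).ennreal_ofReal
    (G.measurable_likelihoodRatio j b b').ennreal_ofReal]
  congr 1
  funext z
  rw [Pi.mul_apply, ← ENNReal.ofReal_mul' (G.likelihoodRatio_nonneg _ _ _ _), condDensity_single,
    condDensity_single, likelihoodRatio, mul_assoc, ← Real.exp_add]
  congr 3
  ring

/-- In an exponential family, the squared ratio times the density at `b` is the density at the
reflected parameter `2 * b' - b` times the exponential of a second difference of `ψ`. The bounds on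
`ψ''` and on the covariates control that factor, and the reflected density integrates to `1`. -/
theorem lintegral_likelihoodRatio_sq_le {c₁ c₂ : ℝ} (hc₂ : 0 ≤ c₂)
    (hx : ∀ᵐ x ∂G.design, ∀ j, |x j| < c₁) (hψ : ∀ u, |deriv (deriv G.ψ) u| ≤ c₂)
    (j : Fin d) (b b' : ℝ) :
    ∫⁻ z, ENNReal.ofReal (G.likelihoodRatio j b b' z) ^ 2 ∂(G.law (EuclideanSpace.single j b)) ≤
      ENNReal.ofReal (Real.exp (c₂ * c₁ ^ 2 * (b' - b) ^ 2 / G.c G.σ)) := by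
  have := G.base_sigmaFinite
  have := G.design_isProbabilityMeasure
  have hc := G.c_pos
  rw [law, lintegral_withDensity_eq_lintegral_mul _ (G.measurable_condDensity _).ennreal_ofReal
    ((G.measurable_likelihoodRatio j b b').ennreal_ofReal.pow_const 2)]
  calc _ ≤ ∫⁻ z, ENNReal.ofReal (Real.exp (c₂ * c₁ ^ 2 * (b' - b) ^ 2 / G.c G.σ)) *
          ENNReal.ofReal (G.condDensity (EuclideanSpace.single j (2 * b' - b)) z.1 z.2)
          ∂(G.base.prod G.design) := by
        refine lintegral_mono_ae ?_
        filter_upwards [Measure.quasiMeasurePreserving_snd.ae hx] with z hz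
        have hzj : (z.2 j * (b' - b)) ^ 2 ≤ c₁ ^ 2 * (b' - b) ^ 2 := by
          rw [mul_pow]
          exact mul_le_mul_of_nonneg_right
            (sq_le_sq' (abs_lt.1 (hz j)).1.le (abs_lt.1 (hz j)).2.le) (sq_nonneg _)
        have hsec := add_sub_two_mul_le_of_abs_deriv_deriv_le G.ψ_contDiff hψ (z.2 j * b')
          (z.2 j * (b' - b))
        rw [Pi.mul_apply, ← ENNReal.ofReal_pow (G.likelihoodRatio_nonneg _ _ _ _),
          ← ENNReal.ofReal_mul' (sq_nonneg _), ← ENNReal.ofReal_mul (Real.exp_nonneg _),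
          condDensity_single, condDensity_single, likelihoodRatio, ← Real.exp_nat_mul, mul_assoc,
          ← Real.exp_add,
          mul_left_comm (Real.exp _) (G.h _ _), ← Real.exp_add]
        refine ENNReal.ofReal_le_ofReal (mul_le_mul_of_nonneg_left (Real.exp_le_exp.2 ?_)
          (G.h_nonneg _))
        rw [← mul_div_assoc, ← add_div, ← add_div]
        refine div_le_div_of_nonneg_right ?_ hc.le
        rw [show z.2 j * b' + z.2 j * (b' - b) = z.2 j * (2 * b' - b) by ring,
          show z.2 j * b' - z.2 j * (b' - b) = z.2 j * b by ring] at hsec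
        have : c₂ * (z.2 j * (b' - b)) ^ 2 ≤ c₂ * (c₁ ^ 2 * (b' - b) ^ 2) := by gcongr
        push_cast
        linarith
    _ = _ := by
        rw [lintegral_const_mul _ (G.measurable_condDensity _).ennreal_ofReal,
          lintegral_condDensity, mul_one]

/-- The output law of `M` on independent records with parameters `t i • e_j`. -/
noncomputable def outputLaw {n : ℕ} (j : Fin d)
    (M : Kernel (Fin n → ℝ × EuclideanSpace ℝ (Fin d)) (EuclideanSpace ℝ (Fin d)))
    (t : Fin n → ℝ) : Measure (EuclideanSpace ℝ (Fin d)) :=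
  (Measure.pi fun i => G.law (EuclideanSpace.single j (t i))).bind M

variable {n : ℕ} (j : Fin d)
  (M : Kernel (Fin n → ℝ × EuclideanSpace ℝ (Fin d)) (EuclideanSpace ℝ (Fin d)))

instance [IsMarkovKernel M] (t : Fin n → ℝ) : IsProbabilityMeasure (G.outputLaw j M t) := by
  refine ⟨?_⟩
  rw [outputLaw, Measure.bind_apply MeasurableSet.univ M.measurable.aemeasurable]
  simp

theorem risk_single (b : ℝ) :
    G.risk M (EuclideanSpace.single j b) =
      ∫⁻ w, ENNReal.ofReal (‖w - EuclideanSpace.single j b‖ ^ 2)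
        ∂(G.outputLaw j M fun _ => b) := by
  have hm : Measurable fun w : EuclideanSpace ℝ (Fin d) =>
      ENNReal.ofReal (‖w - EuclideanSpace.single j b‖ ^ 2) := by fun_prop
  rw [outputLaw, Measure.lintegral_bind M.measurable.aemeasurable hm.aemeasurable]
  rfl

/-- The second moment of the likelihood ratio is multiplicative over independent records; the bound
for `ρ ^ 2` is then used with `g` the probability that `M` outputs a point of `S`. -/
theorem outputLaw_apply_le [IsMarkovKernel M] {c₁ c₂ : ℝ} (hc₂ : 0 ≤ c₂)
    (hx : ∀ᵐ x ∂G.design, ∀ j, |x j| < c₁) (hψ : ∀ u, |deriv (deriv G.ψ) u| ≤ c₂)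
    {t : Fin n → ℝ} {b D : ℝ} (hD : ∀ i, |t i - b| ≤ D) {T : ℝ≥0∞} (hT : T ≠ 0) (hT' : T ≠ ⊤)
    {S : Set (EuclideanSpace ℝ (Fin d))} (hS : MeasurableSet S) :
    G.outputLaw j M t S ≤ T * G.outputLaw j M (fun _ => b) S +
      ENNReal.ofReal (Real.exp (c₂ * c₁ ^ 2 * D ^ 2 / G.c G.σ)) ^ n / T := by
  have hc := G.c_pos
  have hρ : ∀ i, Measurable fun z => ENNReal.ofReal (G.likelihoodRatio j b (t i) z) := fun i =>
    (G.measurable_likelihoodRatio j b (t i)).ennreal_ofReal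
  have hprob : ∀ i, IsProbabilityMeasure ((G.law (EuclideanSpace.single j b)).withDensity
      fun z => ENNReal.ofReal (G.likelihoodRatio j b (t i) z)) := fun i => by
    rw [← law_single_eq_withDensity]
    infer_instance
  have hpi : (Measure.pi fun i => G.law (EuclideanSpace.single j (t i))) =
      (Measure.pi fun _ : Fin n => G.law (EuclideanSpace.single j b)).withDensity
        fun X => ∏ i, ENNReal.ofReal (G.likelihoodRatio j b (t i) (X i)) := by
    rw [← pi_withDensity_prod _ hρ]
    simp_rw [← law_single_eq_withDensity]
  rw [outputLaw, outputLaw, Measure.bind_apply hS M.measurable.aemeasurable,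
    Measure.bind_apply hS M.measurable.aemeasurable, hpi]
  refine lintegral_withDensity_le_of_sq
    (Finset.measurable_fun_prod _ fun i _ => (hρ i).comp (measurable_pi_apply i))
    (M.measurable_coe hS) (fun X => prob_le_one) ?_ hT hT'
  simp only [Function.comp_apply, ← Finset.prod_pow]
  rw [lintegral_pi_prod _ fun i => (hρ i).pow_const 2]
  calc _ ≤ ∏ _i : Fin n, ENNReal.ofReal (Real.exp (c₂ * c₁ ^ 2 * D ^ 2 / G.c G.σ)) := by
        refine Finset.prod_le_prod' fun i _ =>
          (G.lintegral_likelihoodRatio_sq_le hc₂ hx hψ j b (t i)).trans ?_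
        refine ENNReal.ofReal_le_ofReal (Real.exp_le_exp.2 (div_le_div_of_nonneg_right ?_ hc.le))
        have h1 := abs_le.1 (hD i)
        exact mul_le_mul_of_nonneg_left (sq_le_sq' h1.1 h1.2) (by positivity)
    _ = _ := by simp

theorem outputLaw_le_risk_div {b r : ℝ} (hr : 0 < r) :
    G.outputLaw j M (fun _ => b) {w | r ≤ ‖w - EuclideanSpace.single j b‖} ≤
      G.risk M (EuclideanSpace.single j b) / ENNReal.ofReal (r ^ 2) := by
  rw [risk_single]
  refine le_trans (measure_mono fun w hw => ?_) (meas_ge_le_lintegral_div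
    (by fun_prop) (by simpa using hr.ne') ENNReal.ofReal_ne_top)
  exact ENNReal.ofReal_le_ofReal (pow_le_pow_left₀ hr.le hw 2)

end GLM

/-! ### Lower bounds for the risk on a coordinate axis. -/

namespace GLM

variable {d : ℕ} (G : GLM d) {n : ℕ} (j : Fin d)
  (M : Kernel (Fin n → ℝ × EuclideanSpace ℝ (Fin d)) (EuclideanSpace ℝ (Fin d)))

/-- The mean squared error of a private estimator is unbounded along each coordinate axis. -/
theorem iSup_risk_single_eq_top [IsMarkovKernel M] {c₁ c₂ ε δ : ℝ} (hc₂ : 0 ≤ c₂)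
    (hx : ∀ᵐ x ∂G.design, ∀ j, |x j| < c₁) (hψ : ∀ u, |deriv (deriv G.ψ) u| ≤ c₂)
    (hn : 1 ≤ n) (hε : 0 ≤ ε) (hε1 : ε ≤ 1) (hδ : 0 ≤ δ) (hnδ : n * δ ≤ 1 / 16)
    (hM : IsDifferentiallyPrivate M ε δ) :
    ⨆ b : ℝ, G.risk M (EuclideanSpace.single j b) = ⊤ := by
  by_contra htop
  set B := ⨆ b : ℝ, G.risk M (EuclideanSpace.single j b)
  have hproj : Measurable fun w : EuclideanSpace ℝ (Fin d) => w j := by fun_prop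
  let Q : (Fin n → ℝ) → Measure ℝ := fun t => (G.outputLaw j M t).map fun w => w j
  have hQ : ∀ t, IsProbabilityMeasure (Q t) := fun t =>
    Measure.isProbabilityMeasure_map hproj.aemeasurable
  refine not_private_of_accurate hn (Real.one_le_exp hε)
    ((Real.exp_le_exp.2 hε1).trans (Real.exp_one_lt_d9.le.trans (by norm_num))) hδ hnδ Q ?_ ?_
  · intro t t' i h S hS
    have := hM.bind_pi_le (fun i => G.law (EuclideanSpace.single j (t i)))
      (fun i => G.law (EuclideanSpace.single j (t' i))) i (fun k hk => by rw [h k hk])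
      (hproj hS)
    rw [← outputLaw, ← outputLaw, ← Measure.map_apply hproj hS, ← Measure.map_apply hproj hS,
      ← ENNReal.ofReal_toReal (measure_ne_top (Q t') S), ← ENNReal.ofReal_mul (Real.exp_nonneg _),
      ← ENNReal.ofReal_add (by positivity) hδ] at this
    exact ENNReal.toReal_le_of_le_ofReal (by positivity) this
  · intro D
    set χ : ℝ≥0∞ := ENNReal.ofReal (Real.exp (c₂ * c₁ ^ 2 * D ^ 2 / G.c G.σ)) ^ n
    have hχ : χ ≠ ⊤ := ENNReal.pow_ne_top ENNReal.ofReal_ne_top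
    have hχ0 : χ ≠ 0 := pow_ne_zero _ (by simpa using Real.exp_pos _)
    -- With this `T` the term `χ / T` is `1 / 16`. The radius `r` below makes the Markov term `T * B
    -- / r ^ 2` at most `1 / 16` as well, which gives the required `1 / 8`.
    set T : ℝ≥0∞ := 16 * χ
    have hT : T ≠ ⊤ := ENNReal.mul_ne_top (by norm_num) hχ
    have hT0 : T ≠ 0 := mul_ne_zero (by norm_num) hχ0
    have hTB : 16 * (T * B) ≠ ⊤ := ENNReal.mul_ne_top (by norm_num) (ENNReal.mul_ne_top hT htop)
    set r : ℝ := (16 * (T * B)).toReal + 1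
    have hr0 : 0 < r := by positivity
    have hr : 16 * (T * B) ≤ ENNReal.ofReal (r ^ 2) := by
      rw [← ENNReal.ofReal_toReal hTB]
      refine ENNReal.ofReal_le_ofReal ?_
      have : 0 ≤ (16 * (T * B)).toReal := ENNReal.toReal_nonneg
      simp only [r]
      nlinarith
    refine ⟨r, fun t b htb => ?_⟩
    have hS : MeasurableSet {x : ℝ | r < |x - b|} :=
      measurableSet_lt measurable_const (by fun_prop)
    have h1 := G.outputLaw_apply_le j M hc₂ hx hψ htb hT0 hT (hproj hS)
    have h2 : G.outputLaw j M (fun _ => b) ((fun w : EuclideanSpace ℝ (Fin d) => w j) ⁻¹'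
        {x : ℝ | r < |x - b|}) ≤ B / ENNReal.ofReal (r ^ 2) := by
      refine (measure_mono fun w hw => ?_).trans ((G.outputLaw_le_risk_div j M hr0).trans
        (ENNReal.div_le_div_right (le_iSup (fun b : ℝ => G.risk M (EuclideanSpace.single j b)) b) _))
      have h3 := PiLp.norm_apply_le (w - EuclideanSpace.single j b) j
      simp only [PiLp.sub_apply, PiLp.single_apply, if_true, Real.norm_eq_abs] at h3
      exact (le_of_lt hw).trans h3
    have h4 : T * (B / ENNReal.ofReal (r ^ 2)) ≤ 1 / 16 := by
      rw [← mul_div_assoc, ENNReal.div_le_iff (by simpa using hr0.ne') ENNReal.ofReal_ne_top,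
        mul_comm (1 / 16), mul_one_div, ENNReal.le_div_iff_mul_le (by simp) (by simp), mul_comm]
      exact hr
    have h5 : χ / T ≤ 1 / 16 := by
      rw [ENNReal.div_le_iff hT0 hT, one_div, ← mul_assoc,
        ENNReal.inv_mul_cancel (by norm_num) (by norm_num), one_mul]
    have h6 : Q t {x | r < |x - b|} ≤ ENNReal.ofReal (1 / 8) := by
      rw [Measure.map_apply hproj hS]
      refine h1.trans ((add_le_add ((mul_le_mul_right h2 _).trans h4) h5).trans_eq ?_)
      rw [show (1 / 8 : ℝ) = 1 / 16 + 1 / 16 by norm_num,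
        ENNReal.ofReal_add (by norm_num) (by norm_num), ENNReal.ofReal_div_of_pos (by norm_num)]
      simp
    exact ENNReal.toReal_le_of_le_ofReal (by norm_num) h6

/-- A two point lower bound for the mean squared error of an arbitrary estimator. -/
theorem exists_le_risk_single [IsMarkovKernel M] {c₁ c₂ τ : ℝ} (hc₂ : 0 ≤ c₂)
    (hx : ∀ᵐ x ∂G.design, ∀ j, |x j| < c₁) (hψ : ∀ u, |deriv (deriv G.ψ) u| ≤ c₂)
    (hτ : 0 < τ) :
    ∃ b, ENNReal.ofReal
      (τ ^ 2 / (64 * Real.exp (n * (c₂ * c₁ ^ 2 * τ ^ 2 / G.c G.σ)))) ≤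
        G.risk M (EuclideanSpace.single j b) := by
  by_contra! hcon
  set χ := Real.exp (n * (c₂ * c₁ ^ 2 * τ ^ 2 / G.c G.σ))
  have hc := G.c_pos
  have hχ : 1 ≤ χ := Real.one_le_exp (by positivity)
  have hsmall : ∀ b, (G.outputLaw j M fun _ => b).real
      {w | τ / 2 ≤ ‖w - EuclideanSpace.single j b‖} ≤ 1 / (16 * χ) := fun b => by
    have h1 := G.outputLaw_le_risk_div j M (b := b) (half_pos hτ)
    have h2 : G.outputLaw j M (fun _ => b) {w | τ / 2 ≤ ‖w - EuclideanSpace.single j b‖} ≤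
        ENNReal.ofReal (1 / (16 * χ)) := by
      refine h1.trans ((ENNReal.div_le_div_right (hcon b).le _).trans_eq ?_)
      rw [← ENNReal.ofReal_div_of_pos (by positivity)]
      congr 1
      field_simp
      norm_num
    exact ENNReal.toReal_le_of_le_ofReal (by positivity) h2
  set A : Set (EuclideanSpace ℝ (Fin d)) := {w | τ / 2 ≤ ‖w - EuclideanSpace.single j (0 : ℝ)‖}
  have hA : MeasurableSet A := measurableSet_le measurable_const (by fun_prop)
  have hAc : Aᶜ ⊆ {w | τ / 2 ≤ ‖w - EuclideanSpace.single j τ‖} := fun w hw => by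
    simp only [A, Set.mem_compl_iff, Set.mem_ofPred_eq, not_le] at hw
    have h0 : (EuclideanSpace.single j (0 : ℝ) : EuclideanSpace ℝ (Fin d)) = 0 := by simp
    rw [h0, sub_zero] at hw
    have h1 := norm_sub_norm_le (EuclideanSpace.single j τ : EuclideanSpace ℝ (Fin d)) w
    rw [PiLp.norm_single, Real.norm_of_nonneg hτ.le, norm_sub_rev] at h1
    simp only [Set.mem_ofPred_eq]
    linarith
  -- With `T = 4 * χ` the parameter `0` gives `Aᶜ` probability at most `1 / 4 + 1 / 4`, whereas a
  -- small risk at `0` forces at least `15 / 16`.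
  have hcomp := G.outputLaw_apply_le j M hc₂ hx hψ (t := fun _ => 0) (b := τ) (D := τ)
    (fun _ => by simp [abs_of_pos hτ]) (T := ENNReal.ofReal (4 * χ))
    (by simpa using by positivity) ENNReal.ofReal_ne_top hA.compl
  have hcomp' : (G.outputLaw j M fun _ => 0).real Aᶜ ≤
      4 * χ * (G.outputLaw j M fun _ => τ).real Aᶜ + 1 / 4 := by
    rw [← ENNReal.ofReal_pow (Real.exp_nonneg _), ← Real.exp_nat_mul,
      ← ENNReal.ofReal_toReal (measure_ne_top (G.outputLaw j M fun _ => τ) Aᶜ),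
      ← ENNReal.ofReal_mul (by positivity), ← ENNReal.ofReal_div_of_pos (by positivity),
      ← ENNReal.ofReal_add (by positivity) (by positivity)] at hcomp
    refine (ENNReal.toReal_le_of_le_ofReal (by positivity) hcomp).trans_eq ?_
    congr 1
    change χ / (4 * χ) = 1 / 4
    field_simp
  have h0 := hsmall 0
  have h1 := (measureReal_mono hAc (measure_ne_top (G.outputLaw j M fun _ => τ) _)).trans
    (hsmall τ)
  rw [probReal_compl_eq_one_sub hA] at hcomp'
  have h2 : 1 / (16 * χ) ≤ 1 / 16 := by
    rw [div_le_div_iff₀ (by positivity) (by positivity)]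
    linarith
  have h3 : 4 * χ * (G.outputLaw j M fun _ => τ).real Aᶜ ≤ 4 * χ * (1 / (16 * χ)) := by gcongr
  have h4 : 4 * χ * (1 / (16 * χ)) = 1 / 4 := by
    field_simp
    norm_num
  linarith

theorem hammingNorm_single_le_one (b : ℝ) :
    hammingNorm (fun k => (EuclideanSpace.single j b : EuclideanSpace ℝ (Fin d)) k) ≤ 1 := by
  rw [hammingNorm, ← Finset.card_singleton j]
  refine Finset.card_le_card fun k hk => ?_
  by_contra hkj
  simp_all

theorem risk_single_le_iSup {s : ℕ} (hs : 1 ≤ s) (b : ℝ) :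
    G.risk M (EuclideanSpace.single j b) ≤
      ⨆ (β : EuclideanSpace ℝ (Fin d)) (_ : hammingNorm (fun j => β j) ≤ s), G.risk M β :=
  le_iSup₂_of_le _ ((hammingNorm_single_le_one j b).trans hs) le_rfl

end GLM

/-! ### Choice of the constant and the two ranges of `n`. -/

theorem exists_forall_mul_rpow_le {γ K η : ℝ} (hγ : 0 < γ) (hη : 0 < η) :
    ∃ N : ℕ, ∀ n : ℕ, 1 ≤ n → N ≤ n → n * (K * (n : ℝ) ^ (-(1 + γ))) ≤ η := by
  have h : Filter.Tendsto (fun n : ℕ => K * (n : ℝ) ^ (-γ)) Filter.atTop (nhds (K * 0)) :=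
    ((tendsto_rpow_neg_atTop hγ).comp tendsto_natCast_atTop_atTop).const_mul K
  rw [mul_zero] at h
  obtain ⟨N, hN⟩ := Filter.eventually_atTop.1 (h.eventually_le_const hη)
  refine ⟨N, fun n hn hNn => ?_⟩
  have hn0 : (0 : ℝ) < n := by exact_mod_cast hn
  rw [neg_add, Real.rpow_add hn0, Real.rpow_neg_one, mul_left_comm, mul_inv_cancel_left₀ hn0.ne']
  exact hN n hNn

/- Over all sparse `β`, without a bound on `‖β‖`, a private estimator whose `δ` is small compared
with `1 / n` has infinite worst case risk.  For the remaining, boundedly many, sample sizes the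
right hand side is at most a multiple of `c(σ)`, and a two point bound applies. -/
theorem theorem5p1
    (γ₁ γ₂ κ K₁ K₂ C c₁ c₂ : ℝ)
    (hγ₁ : 0 < γ₁) (hγ₂ : 0 < γ₂) (hκ : 0 < κ) (hK₁ : 0 < K₁) (hK₂ : 0 < K₂)
    (hC : 0 < C) (hc₁ : 0 < c₁) (hc₂ : 0 < c₂) :
    ∃ c₀ : ℝ, 0 < c₀ ∧
      ∀ (n d s : ℕ) (ε δ : ℝ) (G : GLM d),
        1 ≤ n → 1 ≤ s → s ≤ d →
        (s : ℝ) ≤ κ * (d : ℝ) ^ (1 - γ₁) →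
        G.secondMoment.IsDiag →
        (∀ μ : ℝ, Module.End.HasEigenvalue (Matrix.toLin' G.secondMoment) μ → μ < C) →
        (∀ᵐ x ∂G.design, ∀ j, |x j| < c₁) →
        (∀ u : ℝ, |deriv (deriv G.ψ) u| ≤ c₂) →
        0 < ε → ε < 1 → 0 ≤ δ →
        (s : ℝ) * Real.log ((d : ℝ) / s) ≤ K₁ * (n * ε) →
        δ ≤ K₂ * (n : ℝ) ^ (-(1 + γ₂)) →
        ENNReal.ofReal (c₀ * (G.c G.σ *
            ((s : ℝ) * Real.log ((d : ℝ) / s) / n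
              + ((s : ℝ) * Real.log ((d : ℝ) / s)) ^ 2 / ((n : ℝ) ^ 2 * ε ^ 2))))
          ≤ G.privateMinimaxRisk n s ε δ := by
  obtain ⟨N, hN⟩ := exists_forall_mul_rpow_le (K := K₂) hγ₂ (by norm_num : (0 : ℝ) < 1 / 16)
  set χ := Real.exp (N * (c₂ * c₁ ^ 2))
  have hχ : 0 < χ := Real.exp_pos _
  refine ⟨1 / (64 * χ * (K₁ + K₁ ^ 2)), by positivity, ?_⟩
  intro n d s ε δ G hn hs hsd _ _ _ hx hψ hε hε1 hδ hL hδn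
  rw [GLM.privateMinimaxRisk]
  refine le_iInf fun M => le_iInf fun hMk => le_iInf fun hMp => ?_
  let j : Fin d := ⟨0, by omega⟩
  have hc := G.c_pos
  have hn0 : (0 : ℝ) < n := by exact_mod_cast hn
  by_cases hnN : N ≤ n
  · have hnδ : n * δ ≤ 1 / 16 :=
      (mul_le_mul_of_nonneg_left hδn hn0.le).trans (hN n hn hnN)
    refine le_top.trans ?_
    rw [← G.iSup_risk_single_eq_top j M hc₂.le hx hψ hn hε.le hε1.le hδ hnδ hMp]
    exact iSup_le fun b => G.risk_single_le_iSup j M hs b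
  -- The separation `√c(σ)` cancels the dispersion in the exponent, so the bound is `c(σ)` times a
  -- constant depending only on `n < N`, `c₁` and `c₂`.
  · obtain ⟨b, hb⟩ := G.exists_le_risk_single j M hc₂.le hx hψ (Real.sqrt_pos.2 hc)
    refine le_trans (ENNReal.ofReal_le_ofReal ?_) (hb.trans (G.risk_single_le_iSup j M hs b))
    rw [Real.sq_sqrt hc.le, mul_div_cancel_right₀ _ hc.ne']
    set L := (s : ℝ) * Real.log ((d : ℝ) / s)
    have hs0 : (0 : ℝ) < s := by exact_mod_cast hs
    have hL0 : 0 ≤ L := mul_nonneg hs0.le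
      (Real.log_nonneg ((one_le_div hs0).2 (by exact_mod_cast hsd)))
    have h1 : L / n ≤ K₁ := by
      rw [div_le_iff₀ hn0]
      refine hL.trans (mul_le_mul_of_nonneg_left ?_ hK₁.le)
      exact mul_le_of_le_one_right hn0.le hε1.le
    have h2 : L ^ 2 / ((n : ℝ) ^ 2 * ε ^ 2) ≤ K₁ ^ 2 := by
      rw [div_le_iff₀ (by positivity), ← mul_pow, ← mul_pow]
      exact pow_le_pow_left₀ hL0 hL 2
    have h3 : Real.exp (n * (c₂ * c₁ ^ 2)) ≤ χ := by
      refine Real.exp_le_exp.2 (mul_le_mul_of_nonneg_right ?_ (by positivity))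
      exact_mod_cast (not_le.1 hnN).le
    calc 1 / (64 * χ * (K₁ + K₁ ^ 2)) * (G.c G.σ * (L / n + L ^ 2 / ((n : ℝ) ^ 2 * ε ^ 2)))
        ≤ 1 / (64 * χ * (K₁ + K₁ ^ 2)) * (G.c G.σ * (K₁ + K₁ ^ 2)) := by gcongr
      _ = G.c G.σ / (64 * χ) := by field_simp
      _ ≤ G.c G.σ / (64 * Real.exp (n * (c₂ * c₁ ^ 2))) := by gcongr
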